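/- Let $M$ be a complex manifold with a holomorphic symplectic form $\Omega$ (a closed, nondegenerate holomorphic $2$-form), and let $GL(n,\mathbb C)$ act on $M$ holomorphically and in a Hamiltonian way. That is, the action preserves $\Omega$ and has a holomorphic moment map $\mu:M\to\mathfrak{gl}(n,\mathbb C)$ (where $\mathfrak{gl}(n,\mathbb C)^*\simeq\mathfrak{gl}(n,\mathbb C)$ by the trace form) which satisfies $\mu(g\cdot p)=g\,\mu(p)\,g^{-1}$ and $d\,\mathrm{tr}(\mu\,\xi)=\Omega(\xi_M,\cdot)$ for all $\xi\in\mathfrak{gl}(n,\mathbb C)$, with $\xi_M(p)=\frac{d}{dz}\big|_{z=0}e^{z\xi}\cdot p$. For $1\le m\le n$ denote by $A_{(m)}$ the upper-left $m\times m$ block of an $n\times n$ matrix $A$, and regard $\mathfrak{gl}(m,\mathbb C)$ as a subalgebra of $\mathfrak{gl}(n,\mathbb C)$ by placing an $m\times m$ matrix in the upper-left block and zeros elsewhere. For $1\le i\le m\le n$ and $p\in M$ let $$B_{mi}(p)=\bigl(\mu(p)_{(m)}\bigr)^{i-1}\in\mathfrak{gl}(m,\mathbb C)\subseteq\mathfrak{gl}(n,\mathbb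 C),$$ where the power is taken in $\mathfrak{gl}(m,\mathbb C)$, so that $B_{m1}(p)$ is the identity of $\mathfrak{gl}(m,\mathbb C)$. Then, for all $1\le i\le m\le n$, the formula $$z\cdot p=e^{zB_{mi}(p)}\cdot p\qquad(z\in\mathbb C,\ p\in M)$$ defines an action of the additive group $\mathbb C$ on $M$. These actions commute for all pairs $(m,i)$. There are $n(n+1)/2$ such pairs, and together the actions induce a holomorphic action of $\mathbb C^{n(n+1)/2}$ on $M$, in which the coordinate copy of $\mathbb C$ with index $(m,i)$ acts by the formula above. -/

import Mathlib

open scoped Manifold ContDiff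

noncomputable section

/-- A `2`-form `Ω` on `M`, read in the preferred chart at `p₀`: the pullback of `Ω` along the inverse
of the chart (meaningful on the target of the chart, an open subset of `E`). -/
def formInChart {E : Type*} [NormedAddCommGroup E] [NormedSpace ℂ E]
    {M : Type*} [TopologicalSpace M] [ChartedSpace E M]
    (Ω : ∀ p : M, TangentSpace 𝓘(ℂ, E) p [⋀^Fin 2]→L[ℂ] ℂ) (p₀ : M) :
    E → E [⋀^Fin 2]→L[ℂ] ℂ :=
  fun y => (Ω ((extChartAt 𝓘(ℂ, E) p₀).symm y)).compContinuousLinearMap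
    (mfderiv 𝓘(ℂ, E) 𝓘(ℂ, E) (extChartAt 𝓘(ℂ, E) p₀).symm y)

/-- A holomorphic symplectic form on the complex manifold `M` (modelled on `E`): a closed,
nondegenerate holomorphic `2`-form. -/
structure HolomorphicSymplecticForm (E : Type*) [NormedAddCommGroup E] [NormedSpace ℂ E]
    (M : Type*) [TopologicalSpace M] [ChartedSpace E M] where
  /-- The value of the form at a point. -/
  form : ∀ p : M, TangentSpace 𝓘(ℂ, E) p [⋀^Fin 2]→L[ℂ] ℂ
  holomorphic : ∀ p₀ : M,
    AnalyticOnNhd ℂ (formInChart form p₀) (extChartAt 𝓘(ℂ, E) p₀).target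
  closed : ∀ p₀ : M, ∀ y ∈ (extChartAt 𝓘(ℂ, E) p₀).target,
    extDeriv (formInChart form p₀) y = 0
  nondegenerate : ∀ (p : M) (v : TangentSpace 𝓘(ℂ, E) p),
    (∀ w : TangentSpace 𝓘(ℂ, E) p, form p ![v, w] = 0) → v = 0

/-- `GL(n, ℂ)` as the group of invertible operators on `ℂⁿ`, which is a complex Lie group (an open
subset of the Banach algebra of all operators). -/
def glEquivUnits (n : ℕ) :
    GL (Fin n) ℂ ≃* (EuclideanSpace ℂ (Fin n) →L[ℂ] EuclideanSpace ℂ (Fin n))ˣ :=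
  Units.mapEquiv (Matrix.toEuclideanCLM (n := Fin n) (𝕜 := ℂ) : _ ≃* _)

/-- The exponential map `gl(n, ℂ) → GL(n, ℂ)`. -/
def expGL {n : ℕ} (A : Matrix (Fin n) (Fin n) ℂ) : GL (Fin n) ℂ where
  val := NormedSpace.exp A
  inv := NormedSpace.exp (-A)
  val_inv := by
    rw [← Matrix.exp_add_of_commute A (-A) (Commute.refl A).neg_right, add_neg_cancel,
      NormedSpace.exp_zero]
  inv_val := by
    rw [← Matrix.exp_add_of_commute (-A) A (Commute.refl A).neg_left, neg_add_cancel,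
      NormedSpace.exp_zero]

/-- The vector field on `M` generated by `ξ ∈ gl(n, ℂ)`: at `p` it is the derivative at `z = 0` of
`z ↦ exp(zξ) • p`. -/
def fundamentalVectorField (E : Type*) [NormedAddCommGroup E] [NormedSpace ℂ E]
    {M : Type*} [TopologicalSpace M] [ChartedSpace E M] {n : ℕ} [MulAction (GL (Fin n) ℂ) M]
    (ξ : Matrix (Fin n) (Fin n) ℂ) (p : M) : TangentSpace 𝓘(ℂ, E) p :=
  (mfderiv 𝓘(ℂ, ℂ) 𝓘(ℂ, E) (fun z : ℂ => expGL (z • ξ) • p) 0 : ℂ →L[ℂ] E) (1 : ℂ)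

/-- The action of `GL(n, ℂ)` on the complex symplectic manifold `(M, Ω)` is Hamiltonian with moment
map `μ`, where `gl(n, ℂ)` is identified with its dual by the trace form. -/
structure IsHamiltonianWith {E : Type*} [NormedAddCommGroup E] [NormedSpace ℂ E]
    {M : Type*} [TopologicalSpace M] [ChartedSpace E M] {n : ℕ} [MulAction (GL (Fin n) ℂ) M]
    (Ω : HolomorphicSymplecticForm E M) (μ : M → Matrix (Fin n) (Fin n) ℂ) : Prop where
  /-- The action is holomorphic. -/
  holomorphic_action :
    ContMDiff
      (𝓘(ℂ, EuclideanSpace ℂ (Fin n) →L[ℂ] EuclideanSpace ℂ (Fin n)).prod 𝓘(ℂ, E)) 𝓘(ℂ, E) ω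
      (fun x : (EuclideanSpace ℂ (Fin n) →L[ℂ] EuclideanSpace ℂ (Fin n))ˣ × M =>
        (glEquivUnits n).symm x.1 • x.2)
  /-- The action preserves the symplectic form. -/
  symplectic : ∀ (g : GL (Fin n) ℂ) (p : M),
    (Ω.form (g • p)).compContinuousLinearMap
      (mfderiv 𝓘(ℂ, E) 𝓘(ℂ, E) (fun q : M => g • q) p) = Ω.form p
  /-- The moment map is holomorphic. -/
  holomorphic_moment : ∀ a b : Fin n, ContMDiff 𝓘(ℂ, E) 𝓘(ℂ, ℂ) ω (fun p : M => μ p a b)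
  /-- The moment map is equivariant for the (co)adjoint action. -/
  equivariant : ∀ (g : GL (Fin n) ℂ) (p : M),
    μ (g • p) = (g : Matrix (Fin n) (Fin n) ℂ) * μ p * ((g⁻¹ : GL (Fin n) ℂ) :
      Matrix (Fin n) (Fin n) ℂ)
  /-- `⟨μ, ξ⟩ = tr (μ ξ)` is a Hamiltonian function of the vector field generated by `ξ`. -/
  moment : ∀ (ξ : Matrix (Fin n) (Fin n) ℂ) (p : M) (v : TangentSpace 𝓘(ℂ, E) p),
    (mfderiv 𝓘(ℂ, E) 𝓘(ℂ, ℂ) (fun q : M => Matrix.trace (μ q * ξ)) p : E →L[ℂ] ℂ) v =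
      Ω.form p ![fundamentalVectorField E ξ p, v]

/-- The pairs `(m, i)` of integers with `1 ≤ i ≤ m ≤ n`. -/
abbrev GZIndex (n : ℕ) : Type := {q : ℕ × ℕ // 1 ≤ q.2 ∧ q.2 ≤ q.1 ∧ q.1 ≤ n}

instance GZIndex.instFintype (n : ℕ) : Fintype (GZIndex n) :=
  Fintype.subtype ((Finset.Icc 1 n ×ˢ Finset.Icc 1 n).filter fun q => q.2 ≤ q.1) (by
    intro q
    simp only [Finset.mem_filter, Finset.mem_product, Finset.mem_Icc]
    omega)

/-- The upper-left `m × m` block `A_(m)` of `A`. -/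
def upperLeft {n m : ℕ} (hm : m ≤ n) (A : Matrix (Fin n) (Fin n) ℂ) : Matrix (Fin m) (Fin m) ℂ :=
  A.submatrix (Fin.castLE hm) (Fin.castLE hm)

/-- The inclusion `gl(m, ℂ) → gl(n, ℂ)`, `m ≤ n`, as the upper-left block, with zeros elsewhere. -/
def upperLeftIncl {m : ℕ} (n : ℕ) (X : Matrix (Fin m) (Fin m) ℂ) : Matrix (Fin n) (Fin n) ℂ :=
  Matrix.of fun a b =>
    if h : (a : ℕ) < m ∧ (b : ℕ) < m then X ⟨a, h.1⟩ ⟨b, h.2⟩ else 0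

/-- `B_{mi}(p) = (μ(p)_(m))^(i-1)`, an element of `gl(m, ℂ) ⊆ gl(n, ℂ)`; the power is taken in
`gl(m, ℂ)`, so that it is the identity of `gl(m, ℂ)` for `i = 1`. -/
def gzElement {M : Type*} {n : ℕ} (μ : M → Matrix (Fin n) (Fin n) ℂ) (q : GZIndex n) (p : M) :
    Matrix (Fin n) (Fin n) ℂ :=
  upperLeftIncl n (upperLeft q.2.2.2 (μ p) ^ (q.1.2 - 1))

/-- The flow `z · p = exp(z B_{mi}(p)) • p`. -/
def gzFlow {M : Type*} {n : ℕ} [MulAction (GL (Fin n) ℂ) M]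
    (μ : M → Matrix (Fin n) (Fin n) ℂ) (q : GZIndex n) (z : ℂ) (p : M) : M :=
  expGL (z • gzElement μ q p) • p

end

/-! Let `P_m` be the projection onto the first `m` coordinates. Then `B_{mi}` is `P_m (P_m μ
P_m)^(i-1)`, which commutes with `P_k` for `k ≥ m` and with `P_m μ P_m`. Hence `g = exp(zB_{mi})`
does too, and the conjugation `μ ↦ gμg⁻¹` caused by the flow leaves `P_m μ P_m` unchanged. So every
`B_{kj}` with `k ≤ m` is constant along the flow of `(m,i)` (`gzMatrix_conj_expGL_of_le`); the case
of `B_{mi}` itself gives the one-parameter law.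

For `k ≥ m`, the same flow only conjugates `B_{kj}` by `g` (`gzMatrix_conj`). Since `exp(w gBg⁻¹) g
= g exp(wB)`, the flows commute. Holomorphy is inherited from the action, `μ` and the exponential.
-/

/-! ### Blocks as compressions by coordinate projections -/

lemma upperLeftIncl_mul {n m : ℕ} (hm : m ≤ n) (X Y : Matrix (Fin m) (Fin m) ℂ) :
    upperLeftIncl n (X * Y) = upperLeftIncl n X * upperLeftIncl n Y := by
  ext a b
  rw [Matrix.mul_apply]
  simp only [upperLeftIncl, Matrix.of_apply]
  split_ifs with h
  · rw [Matrix.mul_apply]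
    refine Fintype.sum_of_injective (Fin.castLE hm) (Fin.castLE_injective hm) _ _ ?_ ?_
    · intro c hc
      have hc' : ¬ (c : ℕ) < m := fun hlt => hc ⟨⟨c, hlt⟩, rfl⟩
      simp [hc']
    · intro c
      simp [h.1, h.2]
  · refine (Finset.sum_eq_zero fun c _ => ?_).symm
    by_cases ha : (a : ℕ) < m
    · have hb : ¬ (b : ℕ) < m := fun hb => h ⟨ha, hb⟩
      simp [hb]
    · simp [ha]

/-- The projection of `ℂⁿ` onto the span of its first `m` coordinate vectors. -/
noncomputable def leadingProj (n m : ℕ) : Matrix (Fin n) (Fin n) ℂ :=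
  Matrix.diagonal fun a => if (a : ℕ) < m then 1 else 0

lemma upperLeftIncl_one (n m : ℕ) :
    upperLeftIncl n (1 : Matrix (Fin m) (Fin m) ℂ) = leadingProj n m := by
  ext a b
  by_cases hab : a = b
  · subst hab
    by_cases ha : (a : ℕ) < m <;> simp [upperLeftIncl, leadingProj, ha]
  · have hab' : (a : ℕ) ≠ b := fun h => hab (Fin.ext h)
    simp [upperLeftIncl, leadingProj, hab, hab', Matrix.one_apply]

lemma upperLeftIncl_upperLeft {n m : ℕ} (hm : m ≤ n) (A : Matrix (Fin n) (Fin n) ℂ) :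
    upperLeftIncl n (upperLeft hm A) = leadingProj n m * A * leadingProj n m := by
  ext a b
  by_cases ha : (a : ℕ) < m <;> by_cases hb : (b : ℕ) < m <;>
    simp [upperLeftIncl, upperLeft, leadingProj, ha, hb, Matrix.diagonal_mul, Matrix.mul_diagonal]

lemma leadingProj_mul_of_le {n k m : ℕ} (h : k ≤ m) :
    leadingProj n k * leadingProj n m = leadingProj n k := by
  rw [leadingProj, leadingProj, Matrix.diagonal_mul_diagonal]
  congr 1
  ext a
  split_ifs <;> first | omega | simp

lemma leadingProj_commute (n k m : ℕ) : Commute (leadingProj n k) (leadingProj n m) := by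
  simp only [Commute, SemiconjBy, leadingProj, Matrix.diagonal_mul_diagonal, mul_comm]

lemma leadingProj_mul_of_ge {n k m : ℕ} (h : k ≤ m) :
    leadingProj n m * leadingProj n k = leadingProj n k := by
  rw [(leadingProj_commute n m k).eq, leadingProj_mul_of_le h]

/-- The compression of `A` to the first `m` coordinates, as an `n × n` matrix. -/
noncomputable def compression {n : ℕ} (m : ℕ) (A : Matrix (Fin n) (Fin n) ℂ) : Matrix (Fin n) (Fin n) ℂ :=
  leadingProj n m * A * leadingProj n m

/-- The left factor matters only for `k = 0`, where it replaces the identity of `gl(n)` by that of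
`gl(m)`. -/
lemma upperLeftIncl_upperLeft_pow {n m : ℕ} (hm : m ≤ n) (A : Matrix (Fin n) (Fin n) ℂ) (k : ℕ) :
    upperLeftIncl n (upperLeft hm A ^ k) = leadingProj n m * compression m A ^ k := by
  induction k with
  | zero => simp [upperLeftIncl_one]
  | succ k ih =>
    rw [pow_succ, upperLeftIncl_mul hm, ih, upperLeftIncl_upperLeft, pow_succ, mul_assoc]
    rfl

lemma compression_compression {n k m : ℕ} (h : k ≤ m) (A : Matrix (Fin n) (Fin n) ℂ) :
    compression k (compression m A) = compression k A := by
  simp only [compression]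
  calc leadingProj n k * (leadingProj n m * A * leadingProj n m) * leadingProj n k
      = (leadingProj n k * leadingProj n m) * A * (leadingProj n m * leadingProj n k) := by
        simp only [mul_assoc]
    _ = _ := by rw [leadingProj_mul_of_le h, leadingProj_mul_of_ge h]

lemma leadingProj_commute_compression {n k m : ℕ} (h : m ≤ k) (A : Matrix (Fin n) (Fin n) ℂ) :
    Commute (leadingProj n k) (compression m A) := by
  rw [Commute, SemiconjBy, compression]
  rw [mul_assoc _ (leadingProj n m) (leadingProj n k), leadingProj_mul_of_le h, ← mul_assoc,
    ← mul_assoc, leadingProj_mul_of_ge h]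

/-- The Gelfand–Zeitlin element as a function of the value of the moment map. -/
noncomputable def gzMatrix {n : ℕ} (q : GZIndex n) (A : Matrix (Fin n) (Fin n) ℂ) : Matrix (Fin n) (Fin n) ℂ :=
  leadingProj n q.1.1 * compression q.1.1 A ^ (q.1.2 - 1)

lemma gzElement_eq {M : Type*} {n : ℕ} (μ : M → Matrix (Fin n) (Fin n) ℂ) (q : GZIndex n) (p : M) :
    gzElement μ q p = gzMatrix q (μ p) :=
  upperLeftIncl_upperLeft_pow _ _ _

lemma gzMatrix_congr {n : ℕ} (q : GZIndex n) {A B : Matrix (Fin n) (Fin n) ℂ}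
    (h : compression q.1.1 A = compression q.1.1 B) : gzMatrix q A = gzMatrix q B := by
  rw [gzMatrix, gzMatrix, h]

lemma leadingProj_commute_gzMatrix {n k : ℕ} (q : GZIndex n) (h : q.1.1 ≤ k)
    (A : Matrix (Fin n) (Fin n) ℂ) : Commute (leadingProj n k) (gzMatrix q A) :=
  (leadingProj_commute n k _).mul_right ((leadingProj_commute_compression h A).pow_right _)

lemma compression_commute_gzMatrix {n : ℕ} (q : GZIndex n) (A : Matrix (Fin n) (Fin n) ℂ) :
    Commute (compression q.1.1 A) (gzMatrix q A) :=
  (leadingProj_commute_compression le_rfl A).symm.mul_right ((Commute.refl _).pow_right _)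

/-! ### Exponentials and conjugation -/

lemma commute_expGL {n : ℕ} {A B : Matrix (Fin n) (Fin n) ℂ} (h : Commute A B) (z : ℂ) :
    Commute A (expGL (z • B) : Matrix (Fin n) (Fin n) ℂ) :=
  (h.smul_right z).exp_right

lemma expGL_zero {n : ℕ} : expGL (0 : Matrix (Fin n) (Fin n) ℂ) = 1 :=
  Units.ext NormedSpace.exp_zero

lemma expGL_add {n : ℕ} {A B : Matrix (Fin n) (Fin n) ℂ} (h : Commute A B) :
    expGL (A + B) = expGL A * expGL B :=
  Units.ext (Matrix.exp_add_of_commute A B h)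

lemma expGL_conj {n : ℕ} (g : GL (Fin n) ℂ) (A : Matrix (Fin n) (Fin n) ℂ) :
    expGL ((g : Matrix (Fin n) (Fin n) ℂ) * A * ((g⁻¹ : GL (Fin n) ℂ) : Matrix (Fin n) (Fin n) ℂ)) = g * expGL A * g⁻¹ :=
  Units.ext (Matrix.exp_units_conj g A)

lemma compression_conj {n m : ℕ} {g : GL (Fin n) ℂ}
    (h : Commute (leadingProj n m) (g : Matrix (Fin n) (Fin n) ℂ))
    (A : Matrix (Fin n) (Fin n) ℂ) :
    compression m ((g : Matrix (Fin n) (Fin n) ℂ) * A * ((g⁻¹ : GL (Fin n) ℂ) : Matrix (Fin n) (Fin n) ℂ)) =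
      g * compression m A * ((g⁻¹ : GL (Fin n) ℂ) : Matrix (Fin n) (Fin n) ℂ) := by
  have h' : Commute (leadingProj n m) ((g⁻¹ : GL (Fin n) ℂ) : Matrix (Fin n) (Fin n) ℂ) :=
    h.units_inv_right
  simp only [compression]
  rw [mul_assoc _ _ (leadingProj n m), mul_assoc _ _ (leadingProj n m), ← h'.eq]
  simp only [← mul_assoc]
  rw [h.eq]

lemma gzMatrix_conj {n : ℕ} (r : GZIndex n) {g : GL (Fin n) ℂ}
    (h : Commute (leadingProj n r.1.1) (g : Matrix (Fin n) (Fin n) ℂ))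
    (A : Matrix (Fin n) (Fin n) ℂ) :
    gzMatrix r ((g : Matrix (Fin n) (Fin n) ℂ) * A * ((g⁻¹ : GL (Fin n) ℂ) : Matrix (Fin n) (Fin n) ℂ)) =
      g * gzMatrix r A * ((g⁻¹ : GL (Fin n) ℂ) : Matrix (Fin n) (Fin n) ℂ) := by
  rw [gzMatrix, compression_conj h, Units.conj_pow, ← mul_assoc, ← mul_assoc, h.eq, gzMatrix,
    mul_assoc _ (leadingProj n _)]

/-- Conjugation by the flow of an index `q` of block size at least that of `r` fixes `gzMatrix r`. -/
lemma gzMatrix_conj_expGL_of_le {n : ℕ} (q r : GZIndex n) (h : r.1.1 ≤ q.1.1) (z : ℂ)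
    (A : Matrix (Fin n) (Fin n) ℂ) :
    gzMatrix r ((expGL (z • gzMatrix q A) : Matrix (Fin n) (Fin n) ℂ) * A *
      ((expGL (z • gzMatrix q A))⁻¹ : GL (Fin n) ℂ)) = gzMatrix r A := by
  apply gzMatrix_congr
  -- It is enough that the larger block, of size `q.1.1`, is fixed. The exponential commutes with
  -- the projection, so the block is conjugated by it, and with the block, so the conjugation
  -- cancels.
  rw [← compression_compression h, compression_conj
    (commute_expGL (leadingProj_commute_gzMatrix q le_rfl A) z),
    ← (commute_expGL (compression_commute_gzMatrix q A) z).eq, mul_assoc, Units.mul_inv, mul_one,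
    compression_compression h]

/-! ### The flows on `M` and their joint action -/

section Flow

/-- `μ` intertwines the action on `M` with conjugation of matrices. -/
def IsConjEquivariant {M : Type*} {n : ℕ} [MulAction (GL (Fin n) ℂ) M]
    (μ : M → Matrix (Fin n) (Fin n) ℂ) : Prop :=
  ∀ (g : GL (Fin n) ℂ) (p : M), μ (g • p) =
    (g : Matrix (Fin n) (Fin n) ℂ) * μ p * ((g⁻¹ : GL (Fin n) ℂ) : Matrix (Fin n) (Fin n) ℂ)

variable {M : Type*} {n : ℕ} [MulAction (GL (Fin n) ℂ) M] {μ : M → Matrix (Fin n) (Fin n) ℂ}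

lemma gzFlow_zero (q : GZIndex n) (p : M) : gzFlow μ q 0 p = p := by
  rw [gzFlow, zero_smul, expGL_zero, one_smul]

lemma gzElement_gzFlow_of_le (hμ : IsConjEquivariant μ)
    (q r : GZIndex n) (h : r.1.1 ≤ q.1.1) (z : ℂ) (p : M) :
    gzElement μ r (gzFlow μ q z p) = gzElement μ r p := by
  rw [gzFlow, gzElement_eq, gzElement_eq, gzElement_eq, hμ, gzMatrix_conj_expGL_of_le q r h]

lemma gzFlow_add (hμ : IsConjEquivariant μ)
    (q : GZIndex n) (z w : ℂ) (p : M) :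
    gzFlow μ q (z + w) p = gzFlow μ q z (gzFlow μ q w p) := by
  rw [gzFlow, gzFlow, gzElement_gzFlow_of_le hμ q q le_rfl, gzFlow, add_smul,
    expGL_add (((Commute.refl _).smul_left z).smul_right w), mul_smul]

lemma gzFlow_comm (hμ : IsConjEquivariant μ)
    (q r : GZIndex n) (z w : ℂ) (p : M) :
    gzFlow μ q z (gzFlow μ r w p) = gzFlow μ r w (gzFlow μ q z p) := by
  -- With `q` the smaller block, the flow of `r` fixes the element of `q`, while the flow of `q`
  -- conjugates the element of `r`.
  wlog h : q.1.1 ≤ r.1.1 generalizing q r z w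
  · exact (this r q w z (le_of_not_ge h)).symm
  have hc := commute_expGL (leadingProj_commute_gzMatrix q h (μ p)) z
  have hL : gzFlow μ q z (gzFlow μ r w p) =
      expGL (z • gzMatrix q (μ p)) • expGL (w • gzMatrix r (μ p)) • p := by
    rw [gzFlow, gzElement_gzFlow_of_le hμ r q h, gzFlow, gzElement_eq, gzElement_eq]
  have hR : gzFlow μ q z p = expGL (z • gzMatrix q (μ p)) • p := by rw [gzFlow, gzElement_eq]
  -- The scalar `w` moves inside the conjugation, and the trailing `g⁻¹` of `exp(gXg⁻¹) = g exp(X)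
  -- g⁻¹` cancels against the first flow.
  rw [hL, hR, gzFlow, gzElement_eq, hμ, gzMatrix_conj r hc, ← smul_mul_assoc, ← mul_smul_comm,
    expGL_conj, smul_smul, smul_smul, inv_mul_cancel_right]

/-- The action of `ℂ` by the flow `gzFlow μ q`, as a homomorphism to the self-maps of `M`. -/
noncomputable def gzFlowHom (hμ : IsConjEquivariant μ)
    (q : GZIndex n) : ℂ →+ Additive (Function.End M) where
  toFun z := Additive.ofMul (gzFlow μ q z)
  map_zero' := funext fun p => gzFlow_zero q p
  map_add' z w := funext fun p => gzFlow_add hμ q z w p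

lemma gzFlowHom_addCommute (hμ : IsConjEquivariant μ) :
    Pairwise fun q r : GZIndex n => ∀ z w : ℂ, AddCommute (gzFlowHom hμ q z) (gzFlowHom hμ r w) :=
  fun q r _ z w => funext fun p => gzFlow_comm hμ q r z w p

/-- The joint action of `ℂ^(n(n+1)/2)`, as a homomorphism to the self-maps of `M`. -/
noncomputable def gzJointHom (hμ : IsConjEquivariant μ) :
    (GZIndex n → ℂ) →+ Additive (Function.End M) :=
  AddMonoidHom.noncommPiCoprod (gzFlowHom hμ) (gzFlowHom_addCommute hμ)

lemma gzJointHom_single (hμ : IsConjEquivariant μ)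
    (q : GZIndex n) (z : ℂ) (p : M) :
    (gzJointHom hμ (Pi.single q z)).toMul p = gzFlow μ q z p := by
  rw [gzJointHom, AddMonoidHom.noncommPiCoprod_single]
  rfl

end Flow

/-! ### Counting the indices -/

lemma card_GZIndex (n : ℕ) : Fintype.card (GZIndex n) = n * (n + 1) / 2 := by
  have e : GZIndex n ≃ Σ m : Fin n, Fin (m + 1) :=
    { toFun := fun q => ⟨⟨q.1.1 - 1, by have := q.2; omega⟩, ⟨q.1.2 - 1, by
        have := q.2; simp only; omega⟩⟩
      invFun := fun s => ⟨(s.1 + 1, s.2 + 1), by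
        have h1 := s.1.2; have h2 := s.2.2; simp only; omega⟩
      left_inv := fun q => by
        have := q.2
        apply Subtype.ext; apply Prod.ext <;> simp only <;> omega
      right_inv := fun s => by simp }
  rw [Fintype.card_congr e, Fintype.card_sigma]
  simp only [Fintype.card_fin]
  rw [Fin.sum_univ_eq_sum_range (fun m => m + 1) n]
  -- The sum of `m + 1` over `m < n` is the sum of `m` over `m < n + 1`, whose zeroth term vanishes.
  have := Finset.sum_range_succ' (fun m => m) n
  simp only [add_zero] at this
  rw [← this, Finset.sum_range_id, add_tsub_cancel_right, mul_comm]

/-! ### Holomorphy of the flows -/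

section Holomorphic

variable {E : Type*} [NormedAddCommGroup E] [NormedSpace ℂ E]
  {M : Type*} [TopologicalSpace M] [ChartedSpace E M] {n : ℕ}

lemma contMDiff_matrix_mul {F G : M → Matrix (Fin n) (Fin n) ℂ}
    (hF : ∀ a b : Fin n, ContMDiff 𝓘(ℂ, E) 𝓘(ℂ, ℂ) ω (fun p : M => F p a b))
    (hG : ∀ a b : Fin n, ContMDiff 𝓘(ℂ, E) 𝓘(ℂ, ℂ) ω (fun p : M => G p a b)) (a b : Fin n) :
    ContMDiff 𝓘(ℂ, E) 𝓘(ℂ, ℂ) ω (fun p : M => (F p * G p) a b) := by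
  simp only [Matrix.mul_apply]
  exact contMDiff_finsetSum fun c _ => (hF a c).mul (hG c b)

lemma contMDiff_matrix_pow {F : M → Matrix (Fin n) (Fin n) ℂ}
    (hF : ∀ a b : Fin n, ContMDiff 𝓘(ℂ, E) 𝓘(ℂ, ℂ) ω (fun p : M => F p a b)) (k : ℕ) :
    ∀ a b : Fin n, ContMDiff 𝓘(ℂ, E) 𝓘(ℂ, ℂ) ω (fun p : M => (F p ^ k) a b) := by
  induction k with
  | zero => simpa only [pow_zero] using fun a b => contMDiff_const
  | succ k ih => simpa only [pow_succ] using contMDiff_matrix_mul ih hF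

lemma contMDiff_gzElement {μ : M → Matrix (Fin n) (Fin n) ℂ}
    (hμ : ∀ a b : Fin n, ContMDiff 𝓘(ℂ, E) 𝓘(ℂ, ℂ) ω (fun p : M => μ p a b)) (q : GZIndex n)
    (a b : Fin n) : ContMDiff 𝓘(ℂ, E) 𝓘(ℂ, ℂ) ω (fun p : M => gzElement μ q p a b) := by
  simp only [gzElement_eq, gzMatrix, compression]
  have hP : ∀ a b : Fin n, ContMDiff 𝓘(ℂ, E) 𝓘(ℂ, ℂ) ω (fun _ : M => leadingProj n q.1.1 a b) :=
    fun _ _ => contMDiff_const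
  exact contMDiff_matrix_mul hP
    (contMDiff_matrix_pow (contMDiff_matrix_mul (contMDiff_matrix_mul hP hμ) hP) _) a b

lemma contMDiff_toEuclideanCLM {F : M → Matrix (Fin n) (Fin n) ℂ}
    (hF : ∀ a b : Fin n, ContMDiff 𝓘(ℂ, E) 𝓘(ℂ, ℂ) ω (fun p : M => F p a b)) :
    ContMDiff 𝓘(ℂ, E) 𝓘(ℂ, EuclideanSpace ℂ (Fin n) →L[ℂ] EuclideanSpace ℂ (Fin n)) ω
      (fun p : M => Matrix.toEuclideanCLM (n := Fin n) (𝕜 := ℂ) (F p)) := by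
  -- Starting from the function space, with its sup norm, reduces holomorphy to the entries; linear
  -- maps out of it are continuous by finite dimension.
  let L : (Fin n → Fin n → ℂ) →ₗ[ℂ] (EuclideanSpace ℂ (Fin n) →L[ℂ] EuclideanSpace ℂ (Fin n)) :=
    (Matrix.toEuclideanCLM (n := Fin n) (𝕜 := ℂ)).toAlgEquiv.toLinearMap ∘ₗ
      (Matrix.ofLinearEquiv ℂ).toLinearMap
  have hF' : ContMDiff 𝓘(ℂ, E) 𝓘(ℂ, Fin n → Fin n → ℂ) ω (fun p : M => fun a b => F p a b) :=
    contMDiff_pi_space.2 fun a => contMDiff_pi_space.2 fun b => hF a b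
  exact L.toContinuousLinearMap.contMDiff.comp hF'

lemma toEuclideanCLM_exp (A : Matrix (Fin n) (Fin n) ℂ) :
    Matrix.toEuclideanCLM (n := Fin n) (𝕜 := ℂ) (NormedSpace.exp A) =
      NormedSpace.exp (Matrix.toEuclideanCLM (n := Fin n) (𝕜 := ℂ) A) := by
  have hc : Continuous (Matrix.toEuclideanCLM (n := Fin n) (𝕜 := ℂ)) :=
    LinearMap.continuous_of_finiteDimensional
      (Matrix.toEuclideanCLM (n := Fin n) (𝕜 := ℂ)).toAlgEquiv.toLinearMap
  open scoped Matrix.Norms.Operator in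
  exact NormedSpace.map_exp _ hc A

lemma contMDiff_gzFlow [MulAction (GL (Fin n) ℂ) M]
    {Ω : HolomorphicSymplecticForm E M} {μ : M → Matrix (Fin n) (Fin n) ℂ}
    (hμ : IsHamiltonianWith Ω μ) (q : GZIndex n) :
    ContMDiff (𝓘(ℂ, ℂ).prod 𝓘(ℂ, E)) 𝓘(ℂ, E) ω (fun x : ℂ × M => gzFlow μ q x.1 x.2) := by
  have hB : ContMDiff (𝓘(ℂ, ℂ).prod 𝓘(ℂ, E))
      𝓘(ℂ, EuclideanSpace ℂ (Fin n) →L[ℂ] EuclideanSpace ℂ (Fin n)) ω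
      (fun x : ℂ × M => x.1 • Matrix.toEuclideanCLM (n := Fin n) (𝕜 := ℂ) (gzElement μ q x.2)) :=
    contMDiff_fst.smul
      ((contMDiff_toEuclideanCLM (contMDiff_gzElement hμ.holomorphic_moment q)).comp contMDiff_snd)
  have hexp : ContDiff ℂ ω (NormedSpace.exp :
      (EuclideanSpace ℂ (Fin n) →L[ℂ] EuclideanSpace ℂ (Fin n)) → _) :=
    contDiff_iff_contDiffAt.2 fun x => (NormedSpace.exp_analytic x).contDiffAt
  have hg : ContMDiff (𝓘(ℂ, ℂ).prod 𝓘(ℂ, E))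
      𝓘(ℂ, EuclideanSpace ℂ (Fin n) →L[ℂ] EuclideanSpace ℂ (Fin n)) ω
      (fun x : ℂ × M => glEquivUnits n (expGL (x.1 • gzElement μ q x.2))) := by
    -- The units are open in the operator algebra, so holomorphy may be checked on the underlying
    -- operator.
    apply ContMDiff.of_comp_isOpenEmbedding Units.isOpenEmbedding_val
    convert hexp.contMDiff.comp hB using 1
    ext1 x
    simp only [Function.comp_apply, ← map_smul, ← toEuclideanCLM_exp]
    rfl
  simpa [gzFlow, Function.comp_def] using
    hμ.holomorphic_action.comp (hg.prodMk contMDiff_snd)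

lemma contMDiff_gzJointHom [MulAction (GL (Fin n) ℂ) M]
    {Ω : HolomorphicSymplecticForm E M} {μ : M → Matrix (Fin n) (Fin n) ℂ}
    (hμ : IsHamiltonianWith Ω μ) :
    ContMDiff (𝓘(ℂ, GZIndex n → ℂ).prod 𝓘(ℂ, E)) 𝓘(ℂ, E) ω
      (fun x : (GZIndex n → ℂ) × M => (gzJointHom hμ.equivariant x.1).toMul x.2) := by
  classical
  let c (v : GZIndex n → ℂ) (s : Finset (GZIndex n)) :
      (s : Set (GZIndex n)).Pairwise
        (Function.onFun AddCommute fun q => gzFlowHom hμ.equivariant q (v q)) :=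
    fun q _ r _ hqr => gzFlowHom_addCommute hμ.equivariant hqr _ _
  -- The joint action is the composite of the flows over all indices; induction on `s` adds one flow
  -- at a time, run for the time given by its own coordinate.
  have key (s : Finset (GZIndex n)) :
      ContMDiff (𝓘(ℂ, GZIndex n → ℂ).prod 𝓘(ℂ, E)) 𝓘(ℂ, E) ω
        (fun x : (GZIndex n → ℂ) × M =>
          (s.noncommSum (fun q => gzFlowHom hμ.equivariant q (x.1 q)) (c x.1 s)).toMul x.2) := by
    induction s using Finset.induction_on with
    | empty => exact contMDiff_snd
    | insert q s hq ih =>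
      have hco : ContMDiff (𝓘(ℂ, GZIndex n → ℂ).prod 𝓘(ℂ, E)) 𝓘(ℂ, ℂ) ω
          (fun x : (GZIndex n → ℂ) × M => x.1 q) :=
        (ContinuousLinearMap.proj (R := ℂ) (φ := fun _ : GZIndex n => ℂ) q).contMDiff.comp
          contMDiff_fst
      convert (contMDiff_gzFlow hμ q).comp (hco.prodMk ih) using 2 with x
      rw [Finset.noncommSum_insert_of_notMem _ _ _ _ hq]
      rfl
  exact key Finset.univ

end Holomorphic

theorem mainTheorem7 {E : Type*} [NormedAddCommGroup E] [NormedSpace ℂ E] [FiniteDimensional ℂ E]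
    {M : Type*} [TopologicalSpace M] [ChartedSpace E M] [IsManifold 𝓘(ℂ, E) ω M]
    (n : ℕ) [MulAction (GL (Fin n) ℂ) M]
    (Ω : HolomorphicSymplecticForm E M) (μ : M → Matrix (Fin n) (Fin n) ℂ)
    (hμ : IsHamiltonianWith Ω μ) :
    -- each flow is an action of `ℂ`
    (∀ (q : GZIndex n) (p : M), gzFlow μ q 0 p = p) ∧
    (∀ (q : GZIndex n) (z w : ℂ) (p : M),
      gzFlow μ q (z + w) p = gzFlow μ q z (gzFlow μ q w p)) ∧
    -- the flows commute
    (∀ (q r : GZIndex n) (z w : ℂ) (p : M),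
      gzFlow μ q z (gzFlow μ r w p) = gzFlow μ r w (gzFlow μ q z p)) ∧
    -- together they give a holomorphic action of `ℂ^(n(n+1)/2)`
    Fintype.card (GZIndex n) = n * (n + 1) / 2 ∧
    ∃ act : AddAction (GZIndex n → ℂ) M,
      (∀ (q : GZIndex n) (z : ℂ) (p : M), act.vadd (Pi.single q z) p = gzFlow μ q z p) ∧
      ContMDiff (𝓘(ℂ, GZIndex n → ℂ).prod 𝓘(ℂ, E)) 𝓘(ℂ, E) ω
        (fun x : (GZIndex n → ℂ) × M => act.vadd x.1 x.2) := by
  refine ⟨gzFlow_zero, gzFlow_add hμ.equivariant, gzFlow_comm hμ.equivariant, card_GZIndex n,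
    AddAction.ofEndHom (gzJointHom hμ.equivariant), fun q z p => ?_, contMDiff_gzJointHom hμ⟩
  exact gzJointHom_single hμ.equivariant q z p
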